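/- Let $\lambda$ denote the uniform (Lebesgue) measure on $2^\omega$ and on $3^\omega$; "random" for $x\in 3^\omega$ means Martin-Löf random with respect to $\lambda$, i.e. $x\notin\bigcap_i U_i$ for every uniformly $\Sigma^0_1$ sequence $(U_i)_{i\in\omega}$ of subsets of $3^\omega$ with $\lambda(U_i)\le 2^{-i}$ for all $i$. For $x\in 3^\omega$ let $T_x\subseteq 2^{<\omega}$ be the tree with $\epsilon\in T_x$ such that, if $\sigma$ is the $(i+1)$-st node of $T_x$ in length-lexicographic order, then the children of $\sigma$ in $T_x$ are only $\sigma 0$ if $x(i)=0$, only $\sigma 1$ if $x(i)=1$, and both if $x(i)=2$. A *random closed set* is a set $C\subseteq 2^\omega$ that equals the set $[T_x]$ of infinite paths through $T_x$ for some random $x\in 3^\omega$. For $x\in 3^\omega$ label the non-empty binary strings, in length-lexicographic order, by $x(0),x(1),x(2),\dots$, and let $F_x:\subseteq 2^\omega\to 2^\omega$ be the partial function for which $F_x(y)$ is the sequence obtained from the labels of $y\restriction 1, y\restriction 2, y\restriction 3,\dots$ by removing all $2$'s (undefined if only finitely many digits remain). A *random continuous function* is a partial function $F:\subseteq 2^\omega\to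 2^\omega$ with $F=F_x$ for some random $x\in 3^\omega$. **Corollary.** Every random closed set $C$ satisfies $\lambda(C)=0$. If $F$ is a random continuous function, then $\lambda(\mathrm{ran}(F))>0$, and $\mathrm{ran}(F)$ is not a random closed set. -/

import Mathlib

namespace AlgRandom

/-- The space `n^ω` of infinite sequences over the alphabet `{0, …, n - 1}`. -/
abbrev Seq (n : ℕ) : Type := ℕ → Fin n

/-- The space `n^{<ω}` of finite strings over the alphabet `{0, …, n - 1}`. -/
abbrev Str (n : ℕ) : Type := List (Fin n)

/-- The initial segment `x ↾ k` of length `k` of the sequence `x`. -/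
def restrict {n : ℕ} (x : Seq n) (k : ℕ) : Str n := (List.range k).map x

/-- The basic clopen set of all sequences that extend the string `σ`. -/
def cylinder {n : ℕ} (σ : Str n) : Set (Seq n) := {x | restrict x σ.length = σ}

/-- The Lebesgue measure on `n^ω`: the product of countably many copies of the uniform probability
measure on `{0, …, n - 1}`. -/
noncomputable def lebesgue (n : ℕ) [NeZero n] : MeasureTheory.Measure (Seq n) :=
  MeasureTheory.Measure.infinitePi fun _ : ℕ => (PMF.uniformOfFintype (Fin n)).toMeasure

/-! ### Martin-Löf randomness -/

/-- `U 0, U 1, …` is a uniformly `Σ⁰₁` sequence of subsets of `n^ω`: a single computably enumerable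
set `W` of pairs (index, string) yields each `U i` as a union of basic clopen sets. -/
def UniformlySigmaOne {n : ℕ} (U : ℕ → Set (Seq n)) : Prop :=
  ∃ W : ℕ × Str n → Prop, REPred W ∧ ∀ i, U i = ⋃ σ ∈ {σ : Str n | W (i, σ)}, cylinder σ

/-- A `μ`-Martin-Löf test. -/
def IsMartinLofTest {n : ℕ} (μ : MeasureTheory.Measure (Seq n)) (U : ℕ → Set (Seq n)) : Prop :=
  UniformlySigmaOne U ∧ ∀ i, μ (U i) ≤ (2⁻¹ : ENNReal) ^ i

/-- `x` is `μ`-Martin-Löf random: it passes every `μ`-Martin-Löf test. -/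
def IsMartinLofRandom {n : ℕ} (μ : MeasureTheory.Measure (Seq n)) (x : Seq n) : Prop :=
  ∀ U : ℕ → Set (Seq n), IsMartinLofTest μ U → x ∉ ⋂ i, U i

/-! ### Random closed sets -/

/-- The children that a node `σ` receives when its digit is `a`: only `σ0` if `a = 0`, only `σ1` if
`a = 1`, and both if `a = 2`. -/
def children (σ : Str 2) (a : Fin 3) : List (Str 2) :=
  if a = 0 then [σ ++ [0]] else if a = 1 then [σ ++ [1]] else [σ ++ [0], σ ++ [1]]

/-- The second component of `codedLevel x k` is the list, in lexicographic order, of the nodes of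
length `k` of the tree `T_x` coded by `x`; the first component is the number of nodes of `T_x` of
length less than `k`. Numbering the nodes of `T_x` from `0` in length-lexicographic order, the
children of node number `i` are determined by the digit `x i`. -/
def codedLevel (x : Seq 3) : ℕ → ℕ × List (Str 2)
  | 0 => (0, [[]])
  | k + 1 =>
    ((codedLevel x k).1 + (codedLevel x k).2.length,
      ((codedLevel x k).2.zipIdx (codedLevel x k).1).flatMap fun p => children p.1 (x p.2))

/-- The tree `T_x` without dead ends coded by `x ∈ 3^ω`. -/
def codedTree (x : Seq 3) : Set (Str 2) := {σ | σ ∈ (codedLevel x σ.length).2}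

/-- The set `[T]` of infinite paths through `T`. -/
def paths (T : Set (Str 2)) : Set (Seq 2) := {y | ∀ k, restrict y k ∈ T}

/-- `C` is a random closed set: `C = [T_x]` for a Martin-Löf random `x ∈ 3^ω`. (Every `[T_x]` is a
non-empty closed set.) -/
def IsRandomClosedSet (C : Set (Seq 2)) : Prop :=
  ∃ x : Seq 3, IsMartinLofRandom (lebesgue 3) x ∧ C = paths (codedTree x)

/-! ### Random continuous functions -/

/-- The position of `σ` in the length-lexicographic enumeration `ε, 0, 1, 00, 01, 10, 11, …` of all
binary strings, starting with position `0` for the empty string. -/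
def lexIndex (σ : Str 2) : ℕ := σ.foldl (fun m b => 2 * m + 1 + (b : ℕ)) 0

/-- The label of the non-empty string `σ`: the nodes other than `ε` are labelled, in
length-lexicographic order, by `x 0, x 1, x 2, …`. -/
def label (x : Seq 3) (σ : Str 2) : Fin 3 := x (lexIndex σ - 1)

/-- The sequence of the labels of `y ↾ 1, y ↾ 2, y ↾ 3, …`. -/
def labelsAlong (x : Seq 3) (y : Seq 2) : Seq 3 := fun k => label x (restrict y (k + 1))

/-- The partial function `F_x` coded by `x`: `F_x(y)` is what is left of the sequence of labels along
`y` after removing all `2`s, and is undefined if only finitely many digits remain. -/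
noncomputable def codedFunction (x : Seq 3) : Seq 2 →. Seq 2 := fun y =>
  ⟨{k : ℕ | labelsAlong x y k ≠ Fin.last 2}.Infinite, fun h j =>
    (labelsAlong x y (Nat.nth (fun k => labelsAlong x y k ≠ Fin.last 2) j)).castPred
      (Nat.nth_mem_of_infinite h j)⟩

/-- The partial function `F` is a random continuous function: `F = F_x` for a Martin-Löf random
`x ∈ 3^ω`. (Every `F_x` is continuous on its domain.) -/
def IsRandomContinuousFunction (F : Seq 2 →. Seq 2) : Prop :=
  ∃ x : Seq 3, IsMartinLofRandom (lebesgue 3) x ∧ F = codedFunction x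

end AlgRandom

open MeasureTheory ProbabilityTheory

namespace AlgRandom

/-! ### Strings and cylinders -/

/-! Closed sets: a node of `T_x` has `4/3` children on average, so `(3/4)^k` times the size of level
`k` extends to a martingale in the digits of `x`. By Ville's inequality it stays bounded along a
random `x`. Level `k` then has `O((4/3)^k)` nodes, and `[T_x]` has measure `O((2/3)^k)` for every
`k`.

Functions: for fixed `y`, the paths whose labels spell `y` up to `2`s form a branching process that
dies out with probability at most `1/4` (`lebesgue_not_consistent_le`). By Fubini and Markov, the
set of surviving `y` has measure below `1/2` with probability at most `1/2`. A measure below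
`2^(-j-1)` at a node forces measures below `2^(-j)` at both children, whose subtrees are
independent, so small measures are improbable (`lebesgue_thinRange_succ_le`). These events form a
Martin-Löf test. For random `x`, a set of positive measure therefore survives all levels. By
compactness each surviving `y` is spelled along an infinite path, and `F_x` is defined there since
no path of a random labelling ends in `2`s only (`IsMartinLofRandom.infinite_labelsAlong_ne_two`).
So the range has positive measure, whereas random closed sets are null. -/

@[simp] theorem length_restrict {n : ℕ} (x : Seq n) (k : ℕ) : (restrict x k).length = k := by
  simp [restrict]

theorem restrict_succ {n : ℕ} (x : Seq n) (k : ℕ) :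
    restrict x (k + 1) = restrict x k ++ [x k] := by
  simp [restrict, List.range_succ]

theorem restrict_succ_eq_cons {n : ℕ} (x : Seq n) (k : ℕ) :
    restrict x (k + 1) = x 0 :: restrict (fun i => x (i + 1)) k := by
  simp [restrict, List.range_succ_eq_map, Function.comp_def]

theorem getElem?_restrict {n : ℕ} (x : Seq n) {i k : ℕ} (h : i < k) :
    (restrict x k)[i]? = some (x i) := by
  simp [restrict, h]

theorem mem_cylinder_iff {n : ℕ} {σ : Str n} {x : Seq n} :
    x ∈ cylinder σ ↔ ∀ i (h : i < σ.length), x i = σ[i] := by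
  constructor
  · intro hx i h
    have h1 := getElem?_restrict x h
    rw [show restrict x σ.length = σ from hx, List.getElem?_eq_getElem h] at h1
    simpa using h1.symm
  · intro hx
    refine List.ext_getElem (by simp) fun i h1 h2 => ?_
    simpa [restrict] using hx i h2

/-! ### The Lebesgue measure -/

instance (n : ℕ) [NeZero n] : IsProbabilityMeasure (lebesgue n) := by
  unfold lebesgue; infer_instance

theorem lebesgue_forall_mem {n : ℕ} [NeZero n] (s : Finset ℕ) (v : ℕ → Fin n) :
    lebesgue n {x | ∀ i ∈ s, x i = v i} = (n : ENNReal)⁻¹ ^ s.card := by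
  have : {x : Seq n | ∀ i ∈ s, x i = v i} = (s : Set ℕ).pi fun i => {v i} := by
    ext; simp [Set.mem_pi]
  rw [this, lebesgue, Measure.infinitePi_pi _ (fun i _ => measurableSet_singleton _)]
  simp

theorem lebesgue_cylinder {n : ℕ} [NeZero n] (σ : Str n) :
    lebesgue n (cylinder σ) = (n : ENNReal)⁻¹ ^ σ.length := by
  rw [← Finset.card_range σ.length, ← lebesgue_forall_mem _ fun i => σ.getD i 0]
  congr 1
  ext x
  rw [mem_cylinder_iff, Set.mem_ofPred_eq]
  refine forall_congr' fun i => ?_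
  rw [Finset.mem_range]
  exact forall_congr' fun h => by rw [List.getD_eq_getElem _ _ h]

theorem lebesgue_eval_eq {n : ℕ} [NeZero n] (i : ℕ) (a : Fin n) :
    lebesgue n {x | x i = a} = (n : ENNReal)⁻¹ := by
  simpa using lebesgue_forall_mem {i} fun _ => a

theorem measurableSet_cylinder {n : ℕ} (σ : Str n) : MeasurableSet (cylinder σ) := by
  have : cylinder σ = ⋂ i, ⋂ h : i < σ.length, {x : Seq n | x i = σ[i]} := by
    ext x; simp [mem_cylinder_iff]
  rw [this]
  exact MeasurableSet.iInter fun i => MeasurableSet.iInter fun h =>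
    measurableSet_eq_fun (measurable_pi_apply i) measurable_const

/-- Events that are determined by disjoint sets of coordinates are independent. -/
theorem lebesgue_inter_of_dependsOn {n : ℕ} [NeZero n] {E E' : Set (Seq n)} {S T : Set ℕ}
    (hE : MeasurableSet E) (hE' : MeasurableSet E') (hS : DependsOn (· ∈ E) S)
    (hT : DependsOn (· ∈ E') T) (hST : Disjoint S T) :
    lebesgue n (E ∩ E') = lebesgue n E * lebesgue n E' := by
  have key : ∀ {E : Set (Seq n)} {S : Set ℕ}, MeasurableSet E → DependsOn (· ∈ E) S →
      MeasurableSet[⨆ i ∈ S, MeasurableSpace.comap (fun x : Seq n => x i) inferInstance] E := by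
    intro E S hE hS
    classical
    -- Erasing the coordinates outside `S` does not affect membership in `E`, and this map is
    -- measurable for the σ-algebra of the coordinates in `S`.
    let f : Seq n → Seq n := fun x i => if i ∈ S then x i else 0
    have hf : E = f ⁻¹' E := by
      ext x
      exact iff_of_eq (hS fun i hi => by simp [f, hi])
    rw [hf]
    refine (@measurable_pi_lambda _ _ _
      (⨆ i ∈ S, MeasurableSpace.comap (fun x : Seq n => x i) inferInstance) _ f fun i => ?_) hE
    by_cases hi : i ∈ S
    · simp only [f, hi, if_true]
      exact Measurable.mono (comap_measurable _) (le_iSup₂_of_le i hi le_rfl) le_rfl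
    · simp only [f, hi, if_false]
      exact measurable_const
  have hind : iIndepFun (fun i (x : Seq n) => x i) (lebesgue n) :=
    iIndepFun_infinitePi (X := fun _ => id) fun _ => measurable_id
  exact (Indep_iff _ _ _).1 (indep_iSup_of_disjoint (fun i => (measurable_pi_apply i).comap_le)
    hind.iIndep hST) _ _ (key hE hS) (key hE' hT)

/-! ### Passing tests -/

/-- The form in which tests are used below: a decidable property of prefixes, whose `i`-th open set
consists of the sequences with some prefix satisfying it. -/
theorem IsMartinLofRandom.exists_forall_not {n : ℕ} {μ : Measure (Seq n)} {x : Seq n}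
    (hx : IsMartinLofRandom μ x) {P : ℕ × Str n → Prop} (hP : PrimrecPred P)
    (hμ : ∀ i, μ {x | ∃ k, P (i, restrict x k)} ≤ (2⁻¹ : ENNReal) ^ i) :
    ∃ i, ∀ k, ¬ P (i, restrict x k) := by
  by_contra! h
  refine hx (fun i => {x | ∃ k, P (i, restrict x k)}) ⟨⟨P, ?_, fun i => ?_⟩, hμ⟩
    (Set.mem_iInter.2 h)
  · obtain ⟨_, hd⟩ := hP
    exact ComputablePred.to_re ⟨_, hd.to_comp⟩
  · ext x
    simp only [Set.mem_ofPred_eq, Set.mem_iUnion, exists_prop]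
    constructor
    · rintro ⟨k, hk⟩
      exact ⟨_, hk, by simp [cylinder]⟩
    · rintro ⟨σ, hσ, hx⟩
      exact ⟨σ.length, by rwa [show restrict x σ.length = σ from hx]⟩

/-- Ville's inequality for supermartingales, up to a finite time. -/
theorem ville_finite {n : ℕ} [NeZero n] {d : Str n → ENNReal}
    (hd : ∀ σ, ∑ a, d (σ ++ [a]) ≤ n * d σ) (c : ENNReal) (N : ℕ) (σ : Str n) :
    c * lebesgue n {x ∈ cylinder σ | ∃ k ≤ N, c ≤ d (restrict x (σ.length + k))} ≤
      d σ * (n : ENNReal)⁻¹ ^ σ.length := by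
  have hn : (n : ENNReal) ≠ 0 := Nat.cast_ne_zero.2 (NeZero.ne n)
  induction N generalizing σ with
  | zero =>
    by_cases h : c ≤ d σ
    · rw [← lebesgue_cylinder]
      exact mul_le_mul' h (measure_mono fun x hx => hx.1)
    · have : {x ∈ cylinder σ | ∃ k ≤ 0, c ≤ d (restrict x (σ.length + k))} = ∅ := by
        refine Set.eq_empty_of_forall_notMem ?_
        rintro x ⟨hx, k, hk, hc⟩
        obtain rfl : k = 0 := by omega
        exact h (by rwa [add_zero, show restrict x σ.length = σ from hx] at hc)
      rw [this]
      simp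
  | succ N ih =>
    by_cases h : c ≤ d σ
    · rw [← lebesgue_cylinder]
      exact mul_le_mul' h (measure_mono fun x hx => hx.1)
    -- The threshold is not yet reached at `σ`, so it is reached below one of the one-letter
    -- extensions.
    · have hsub : {x ∈ cylinder σ | ∃ k ≤ N + 1, c ≤ d (restrict x (σ.length + k))} ⊆
          ⋃ a, {x ∈ cylinder (σ ++ [a]) |
            ∃ k ≤ N, c ≤ d (restrict x ((σ ++ [a]).length + k))} := by
        rintro x ⟨hx, k, hk, hc⟩
        have hx' : restrict x σ.length = σ := hx
        refine Set.mem_iUnion.2 ⟨x σ.length, ?_, ?_⟩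
        · change restrict x _ = _
          rw [List.length_append, List.length_singleton, restrict_succ, hx']
        · cases k with
          | zero => exact absurd (by rwa [add_zero, hx'] at hc) h
          | succ k =>
            refine ⟨k, by omega, ?_⟩
            rw [List.length_append, List.length_singleton]
            rwa [show σ.length + 1 + k = σ.length + (k + 1) by ring]
      calc _ ≤ c * ∑ a, lebesgue n {x ∈ cylinder (σ ++ [a]) |
            ∃ k ≤ N, c ≤ d (restrict x ((σ ++ [a]).length + k))} := by
            gcongr
            exact (measure_mono hsub).trans (measure_iUnion_fintype_le _ _)
        _ ≤ ∑ a, d (σ ++ [a]) * (n : ENNReal)⁻¹ ^ (σ.length + 1) := by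
            rw [Finset.mul_sum]
            refine Finset.sum_le_sum fun a _ => ?_
            simpa using ih (σ ++ [a])
        _ ≤ n * d σ * (n : ENNReal)⁻¹ ^ (σ.length + 1) := by
            rw [← Finset.sum_mul]
            gcongr
            exact hd σ
        _ = d σ * (n : ENNReal)⁻¹ ^ σ.length := by
            rw [pow_succ, mul_comm (n : ENNReal), mul_assoc, mul_comm (_ ^ _), ← mul_assoc (n : ENNReal),
              ENNReal.mul_inv_cancel hn (ENNReal.natCast_ne_top n), one_mul]

/-- Ville's inequality for supermartingales. -/
theorem ville {n : ℕ} [NeZero n] {d : Str n → ENNReal}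
    (hd : ∀ σ, ∑ a, d (σ ++ [a]) ≤ n * d σ) (c : ENNReal) :
    c * lebesgue n {x | ∃ k, c ≤ d (restrict x k)} ≤ d [] := by
  have hU : {x | ∃ k, c ≤ d (restrict x k)} = ⋃ N : ℕ, {x | ∃ k ≤ N, c ≤ d (restrict x k)} := by
    ext x
    simp only [Set.mem_ofPred_eq, Set.mem_iUnion]
    exact ⟨fun ⟨k, hk⟩ => ⟨k, k, le_rfl, hk⟩, fun ⟨_, k, _, hk⟩ => ⟨k, hk⟩⟩
  have hmono : Monotone fun N : ℕ => {x : Seq n | ∃ k ≤ N, c ≤ d (restrict x k)} :=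
    fun _ _ h _ ⟨k, hk, hc⟩ => ⟨k, hk.trans h, hc⟩
  rw [hU, hmono.measure_iUnion, ENNReal.mul_iSup]
  refine iSup_le fun N => ?_
  simpa [cylinder, restrict] using ville_finite hd c N []

/-! ### Random closed sets are null sets -/

/-- Processing one node of `T_x`. In the state `(k, r, c)`, the next node to be processed belongs to
level `k`, it is followed by `r` further nodes of that level, and `c` nodes of level `k + 1` have
been found so far. -/
def closedStep (s : ℕ × ℕ × ℕ) (a : Fin 3) : ℕ × ℕ × ℕ :=
  if s.2.1 = 0 then (s.1 + 1, s.2.2 + (if a = 2 then 1 else 0), 0)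
  else (s.1, s.2.1 - 1, s.2.2 + (if a = 2 then 2 else 1))

/-- The state that is reached after processing as many nodes as there are digits in `σ`. -/
def closedState (σ : Str 3) : ℕ × ℕ × ℕ := σ.foldl closedStep (0, 0, 0)

/-- The conditional expectation of `(3/4)^j` times the size of level `j`, for large `j`, in a given
state. -/
noncomputable def closedWeight (s : ℕ × ℕ × ℕ) : NNReal :=
  3 ^ s.1 * (4 * (s.2.1 + 1) + 3 * s.2.2) / 4 ^ (s.1 + 1)

/-- The martingale property: an unprocessed node counts as `4/3` nodes of the next level. Since `r`
omits the node being processed, `r = 0` means that this step completes the level. -/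
theorem sum_closedWeight_closedStep (s : ℕ × ℕ × ℕ) :
    ∑ a, closedWeight (closedStep s a) = 3 * closedWeight s := by
  obtain ⟨k, r, c⟩ := s
  have h0 : (0 : Fin 3) ≠ 2 := by decide
  have h1 : (1 : Fin 3) ≠ 2 := by decide
  rcases r with _ | r
  · simp only [Fin.sum_univ_three, closedStep, closedWeight, h0, h1, if_true, if_false]
    push_cast
    field_simp
    ring
  · simp only [Fin.sum_univ_three, closedStep, closedWeight, h0, h1, if_true, if_false,
      Nat.succ_ne_zero, Nat.add_sub_cancel]
    push_cast
    field_simp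
    ring

theorem closedState_append (σ τ : Str 3) :
    closedState (σ ++ τ) = τ.foldl closedStep (closedState σ) := List.foldl_append

theorem lebesgue_closedWeight_ge_le (i : ℕ) :
    lebesgue 3 {x | ∃ k, 2 ^ i ≤ closedWeight (closedState (restrict x k))} ≤ 2⁻¹ ^ i := by
  have h := ville (n := 3) (d := fun σ => (closedWeight (closedState σ) : ENNReal))
    (fun σ => by
      simp only [closedState_append, List.foldl_cons, List.foldl_nil]
      rw [← ENNReal.ofNNReal_finsetSum, sum_closedWeight_closedStep]
      simp) (2 ^ i)
  have h1 : closedWeight (closedState []) = 1 := by simp [closedState, closedWeight]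
  simp only [h1, ENNReal.coe_one] at h
  rw [← ENNReal.inv_pow, ENNReal.le_inv_iff_mul_le, mul_comm]
  convert h using 5
  norm_cast

/-- Clearing denominators leaves a comparison of natural numbers, which is primitive recursive. -/
theorem two_pow_le_closedWeight_iff (i : ℕ) (s : ℕ × ℕ × ℕ) :
    2 ^ i ≤ closedWeight s ↔ 2 ^ i * 4 ^ (s.1 + 1) ≤ 3 ^ s.1 * (4 * (s.2.1 + 1) + 3 * s.2.2) := by
  rw [closedWeight, le_div_iff₀ (by positivity)]
  norm_cast

theorem primrec_pow : Primrec₂ fun m n : ℕ => m ^ n :=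
  Primrec₂.unpaired'.1 Nat.Primrec.pow

theorem primrec_closedState : Primrec closedState := by
  have hk : Primrec fun p : Str 3 × (ℕ × ℕ × ℕ) × Fin 3 => p.2.1.1 :=
    Primrec.fst.comp (Primrec.fst.comp Primrec.snd)
  have hr : Primrec fun p : Str 3 × (ℕ × ℕ × ℕ) × Fin 3 => p.2.1.2.1 :=
    Primrec.fst.comp (Primrec.snd.comp (Primrec.fst.comp Primrec.snd))
  have hc : Primrec fun p : Str 3 × (ℕ × ℕ × ℕ) × Fin 3 => p.2.1.2.2 :=
    Primrec.snd.comp (Primrec.snd.comp (Primrec.fst.comp Primrec.snd))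
  have ha : Primrec fun p : Str 3 × (ℕ × ℕ × ℕ) × Fin 3 => p.2.2 :=
    Primrec.snd.comp Primrec.snd
  have hf : ∀ f : Fin 3 → ℕ, Primrec fun p : Str 3 × (ℕ × ℕ × ℕ) × Fin 3 => p.2.1.2.2 + f p.2.2 :=
    fun f => Primrec.nat_add.comp hc ((Primrec.dom_finite f).comp ha)
  refine Primrec.list_foldl Primrec.id (Primrec.const _)
    (h := fun _ p => closedStep p.1 p.2) (Primrec₂.mk ?_)
  exact Primrec.ite (Primrec.eq.comp hr (Primrec.const 0))
    ((Primrec.succ.comp hk).pair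
      ((hf fun a => if a = 2 then 1 else 0).pair (Primrec.const 0)))
    (hk.pair ((Primrec.nat_sub.comp hr (Primrec.const 1)).pair (hf fun a => if a = 2 then 2 else 1)))

theorem primrecPred_two_pow_le_closedWeight :
    PrimrecPred fun p : ℕ × Str 3 => 2 ^ p.1 ≤ closedWeight (closedState p.2) := by
  have hs : Primrec fun p : ℕ × Str 3 => closedState p.2 := primrec_closedState.comp Primrec.snd
  have hk := Primrec.fst.comp hs
  have hr := Primrec.fst.comp (Primrec.snd.comp hs)
  have hc := Primrec.snd.comp (Primrec.snd.comp hs)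
  have hle : PrimrecPred fun p : ℕ × Str 3 => 2 ^ p.1 * 4 ^ ((closedState p.2).1 + 1) ≤
      3 ^ (closedState p.2).1 *
        (4 * ((closedState p.2).2.1 + 1) + 3 * (closedState p.2).2.2) :=
    Primrec.nat_le.comp
      (Primrec.nat_mul.comp (primrec_pow.comp (Primrec.const 2) Primrec.fst)
        (primrec_pow.comp (Primrec.const 4) (Primrec.succ.comp hk)))
      (Primrec.nat_mul.comp (primrec_pow.comp (Primrec.const 3) hk)
        (Primrec.nat_add.comp (Primrec.nat_mul.comp (Primrec.const 4) (Primrec.succ.comp hr))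
          (Primrec.nat_mul.comp (Primrec.const 3) hc)))
  exact hle.of_eq fun p => (two_pow_le_closedWeight_iff _ _).symm

/-- One pass through the rest of a level. The count `c` of children already found is arbitrary so
that the induction on the remaining nodes works. -/
theorem foldl_closedStep_level (l : List (Str 2)) (x : Seq 3) (n k c : ℕ) (hl : l ≠ []) :
    ((List.range' n l.length).map x).foldl closedStep (k, l.length - 1, c) =
      (k + 1, c + ((l.zipIdx n).flatMap fun p => children p.1 (x p.2)).length - 1, 0) := by
  induction l generalizing n c with
  | nil => exact absurd rfl hl
  | cons σ l ih =>
    have hc : (children σ (x n)).length = if x n = 2 then 2 else 1 := by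
      unfold children
      generalize x n = a
      fin_cases a <;> rfl
    rcases l with _ | ⟨τ, l⟩
    · simp [closedStep, hc]
      split_ifs <;> rfl
    · have h := ih (n + 1) (c + (if x n = 2 then 2 else 1)) (by simp)
      rw [List.length_cons, List.range'_succ, List.map_cons, List.foldl_cons, closedStep,
        if_neg (by simp)]
      simp only [List.length_cons] at h
      simp only [List.length_cons, Nat.add_sub_cancel] at h ⊢
      rw [h]
      simp only [List.zipIdx_cons, List.flatMap_cons, List.length_append, hc]
      congr 2
      omega

theorem codedLevel_ne_nil (x : Seq 3) (k : ℕ) : (codedLevel x k).2 ≠ [] := by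
  induction k with
  | zero => simp [codedLevel]
  | succ k ih =>
    obtain ⟨σ, l, h⟩ := List.exists_cons_of_ne_nil ih
    rw [codedLevel, h]
    simp only [List.zipIdx_cons, List.flatMap_cons]
    unfold children
    split_ifs <;> simp

/-- At the start of level `k` the weight is thus exactly `(3/4)^k` times the size of that level. -/
theorem closedState_restrict_codedLevel (x : Seq 3) (k : ℕ) :
    closedState (restrict x (codedLevel x k).1) = (k, (codedLevel x k).2.length - 1, 0) := by
  induction k with
  | zero => rfl
  | succ k ih =>
    have : restrict x (codedLevel x (k + 1)).1 = restrict x (codedLevel x k).1 ++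
        (List.range' (codedLevel x k).1 (codedLevel x k).2.length).map x := by
      rw [restrict, restrict, ← List.map_append, codedLevel, List.range_eq_range',
        List.range_eq_range', List.range'_eq_append_iff.2 ⟨_, Nat.le_add_right _ _, rfl, rfl⟩]
      simp
    rw [this, closedState_append, ih, foldl_closedStep_level _ _ _ _ _ (codedLevel_ne_nil x k),
      zero_add]
    rfl

theorem lebesgue_paths_codedTree_le (x : Seq 3) (k : ℕ) :
    lebesgue 2 (paths (codedTree x)) ≤ (codedLevel x k).2.length * 2⁻¹ ^ k := by
  -- Filtering by length avoids proving that all entries of level `k` have length `k`.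
  have hsub : paths (codedTree x) ⊆
      ⋃ σ ∈ (codedLevel x k).2.toFinset.filter (·.length = k), cylinder σ := by
    intro y hy
    have h := hy k
    simp only [codedTree, Set.mem_ofPred_eq, length_restrict] at h
    simp only [Set.mem_iUnion]
    exact ⟨restrict y k, by simpa using h, by simp [cylinder]⟩
  calc _ ≤ ∑ σ ∈ (codedLevel x k).2.toFinset.filter (·.length = k), lebesgue 2 (cylinder σ) :=
        (measure_mono hsub).trans (measure_biUnion_finset_le _ _)
    _ = ∑ σ ∈ (codedLevel x k).2.toFinset.filter (·.length = k), (2⁻¹ : ENNReal) ^ k := by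
        refine Finset.sum_congr rfl fun σ hσ => ?_
        rw [lebesgue_cylinder, (Finset.mem_filter.1 hσ).2, Nat.cast_ofNat]
    _ ≤ _ := by
        rw [Finset.sum_const, nsmul_eq_mul]
        gcongr
        exact (Finset.card_filter_le _ _).trans (List.toFinset_card_le _)

theorem lebesgue_paths_codedTree_eq_zero {x : Seq 3} (hx : IsMartinLofRandom (lebesgue 3) x) :
    lebesgue 2 (paths (codedTree x)) = 0 := by
  obtain ⟨i, hi⟩ := hx.exists_forall_not primrecPred_two_pow_le_closedWeight
    lebesgue_closedWeight_ge_le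
  have hbound : ∀ k, lebesgue 2 (paths (codedTree x)) ≤ ((2 ^ i * (2 / 3) ^ k : NNReal) : ENNReal) := by
    intro k
    have h1 := hi (codedLevel x k).1
    rw [closedState_restrict_codedLevel, not_le, closedWeight] at h1
    refine (lebesgue_paths_codedTree_le x k).trans ?_
    have hpos : 0 < (codedLevel x k).2.length := List.length_pos_iff.2 (codedLevel_ne_nil x k)
    have h2 : (((codedLevel x k).2.length - 1 : ℕ) : NNReal) + 1 = (codedLevel x k).2.length := by
      norm_cast
      omega
    simp only [h2] at h1
    have h3 : ((codedLevel x k).2.length : NNReal) * 2⁻¹ ^ k ≤ 2 ^ i * (2 / 3) ^ k := by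
      rw [Nat.cast_zero, mul_zero, add_zero, div_lt_iff₀ (by positivity), pow_succ] at h1
      have h4 : 3 ^ k * ((codedLevel x k).2.length : NNReal) ≤ 2 ^ i * 4 ^ k := by
        have : 4 * (3 ^ k * ((codedLevel x k).2.length : NNReal)) ≤ 4 * (2 ^ i * 4 ^ k) := by
          refine le_of_eq_of_le ?_ (h1.le.trans_eq ?_) <;> ring
        exact le_of_mul_le_mul_left this (by norm_num)
      rw [inv_pow, div_pow, ← div_eq_mul_inv, div_le_iff₀ (by positivity), ← mul_div_assoc,
        div_mul_eq_mul_div, le_div_iff₀ (by positivity)]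
      calc _ = 3 ^ k * ((codedLevel x k).2.length : NNReal) := mul_comm _ _
        _ ≤ _ := h4
        _ = _ := by rw [mul_assoc, ← mul_pow]; norm_num
    calc _ = (((codedLevel x k).2.length * 2⁻¹ ^ k : NNReal) : ENNReal) := by
          push_cast
          rfl
      _ ≤ _ := ENNReal.coe_le_coe.2 h3
  have hlim : Filter.Tendsto (fun k => ((2 ^ i * (2 / 3) ^ k : NNReal) : ENNReal)) Filter.atTop
      (nhds 0) := by
    rw [← ENNReal.coe_zero, ENNReal.tendsto_coe]
    have : (2 / 3 : NNReal) < 1 := by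
      rw [div_lt_one (by norm_num)]
      norm_num
    simpa using (NNReal.tendsto_pow_atTop_nhds_zero_of_lt_one this).const_mul (2 ^ i)
  exact le_antisymm (ge_of_tendsto' hlim hbound) zero_le

/-! ### The range of a random continuous function: probabilities -/

theorem lebesgue_map_tail (n : ℕ) [NeZero n] :
    (lebesgue n).map (fun y i => y (i + 1)) = lebesgue n :=
  Measure.map_infinitePi_infinitePi_of_inj (add_left_injective 1)

theorem measurable_tail (n : ℕ) : Measurable fun (y : Seq n) i => y (i + 1) := by fun_prop

theorem lebesgue_eval_zero_and_tail {n : ℕ} [NeZero n] (c : Fin n) {S : Set (Seq n)}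
    (hS : MeasurableSet S) :
    lebesgue n {y | y 0 = c ∧ (fun i => y (i + 1)) ∈ S} = (n : ENNReal)⁻¹ * lebesgue n S := by
  have h := lebesgue_inter_of_dependsOn (n := n) (E := {y | y 0 = c})
    (E' := (fun y i => y (i + 1)) ⁻¹' S) (S := {0}) (T := {i | 0 < i})
    (measurableSet_eq_fun (measurable_pi_apply 0) measurable_const) (measurable_tail n hS)
    (fun y z h => by simp [h 0 rfl])
    (fun y z h => by
      have : (fun i => y (i + 1)) = fun i => z (i + 1) := funext fun i => h _ (Nat.succ_pos i)
      simp [this])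
    (by simp)
  rw [lebesgue_eval_eq, ← Measure.map_apply (measurable_tail n) hS, lebesgue_map_tail] at h
  exact h

/-- Some path that starts in the node with number `m` and has length `k` has labels whose digits
other than `2` form an initial segment of `y`. -/
def Consistent (x : Seq 3) : ℕ → ℕ → Seq 2 → Prop
  | 0, _, _ => True
  | k + 1, m, y => ∃ b : Fin 2,
      (x (2 * m + b) = 2 ∧ Consistent x k (2 * m + 1 + b) y) ∨
      (x (2 * m + b) = (y 0).castSucc ∧ Consistent x k (2 * m + 1 + b) fun i => y (i + 1))

/-- The positions of the labels of the descendants of the node with number `m`, up to `k` levels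
below that node. -/
def labelsBelow (k m : ℕ) : Set ℕ := {i | ∃ j, 0 < j ∧ j ≤ k ∧ (i + 2) / 2 ^ j = m + 1}

/-- Node `m` has children `2m + 1 + b`, and position `i` labels node `i + 1`. In binary, a node
number plus one is `1` followed by the string, so dividing `i + 2` by `2^j` climbs `j` levels. -/
theorem add_mem_labelsBelow_succ (k m : ℕ) (b : Fin 2) : 2 * m + b ∈ labelsBelow (k + 1) m :=
  ⟨1, one_pos, by omega, by omega⟩

theorem labelsBelow_child_subset (k m : ℕ) (b : Fin 2) :
    labelsBelow k (2 * m + 1 + b) ⊆ labelsBelow (k + 1) m := by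
  rintro i ⟨j, _, hk, h⟩
  refine ⟨j + 1, by omega, by omega, ?_⟩
  rw [pow_succ, ← Nat.div_div_eq_div_mul, h]
  omega

theorem add_notMem_labelsBelow_child (k m : ℕ) (b c : Fin 2) :
    2 * m + b ∉ labelsBelow k (2 * m + 1 + c) := by
  rintro ⟨j, hj, _, h⟩
  have : (2 * m + b + 2) / 2 ^ j ≤ (2 * m + b + 2) / 2 ^ 1 :=
    Nat.div_le_div_left (Nat.pow_le_pow_right two_pos hj) (by norm_num)
  omega

/-- A common descendant would have two different ancestors on one level, or make one sibling a
descendant of the other. -/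
theorem disjoint_labelsBelow_children (k l m : ℕ) :
    Disjoint (labelsBelow k (2 * m + 1)) (labelsBelow l (2 * m + 2)) := by
  rw [Set.disjoint_left]
  rintro i ⟨p, _, _, hp⟩ ⟨q, _, _, hq⟩
  rcases lt_trichotomy p q with h | rfl | h
  · obtain ⟨r, rfl⟩ := Nat.exists_eq_add_of_lt h
    rw [add_assoc, pow_add, ← Nat.div_div_eq_div_mul, hp] at hq
    have := Nat.div_le_self (2 * m + 1 + 1) (2 ^ (r + 1))
    omega
  · omega
  · obtain ⟨r, rfl⟩ := Nat.exists_eq_add_of_lt h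
    rw [add_assoc, pow_add, ← Nat.div_div_eq_div_mul, hq, pow_succ', ← Nat.div_div_eq_div_mul] at hp
    have := Nat.div_le_self ((2 * m + 2 + 1) / 2) (2 ^ r)
    omega

theorem lt_of_mem_labelsBelow_zero {k i : ℕ} (h : i ∈ labelsBelow k 0) : i < 2 ^ (k + 1) := by
  obtain ⟨j, _, hk, h⟩ := h
  rw [Nat.div_eq_iff (by positivity)] at h
  have : 2 ^ j ≤ 2 ^ k := Nat.pow_le_pow_right two_pos hk
  rw [pow_succ]
  omega

theorem dependsOn_consistent (k m : ℕ) (y : Seq 2) :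
    DependsOn (fun x => Consistent x k m y) (labelsBelow k m) := by
  induction k generalizing m y with
  | zero => exact fun _ _ _ => rfl
  | succ k ih =>
    intro x z h
    simp only [Consistent]
    have h1 : ∀ b : Fin 2, x (2 * m + b) = z (2 * m + b) := fun b =>
      h _ (add_mem_labelsBelow_succ k m b)
    have h2 : ∀ (b : Fin 2) y, Consistent x k (2 * m + 1 + b) y = Consistent z k (2 * m + 1 + b) y :=
      fun b y => ih _ y fun i hi => h i (labelsBelow_child_subset k m b hi)
    simp only [h1, h2]

theorem measurableSet_consistent_prod (k m : ℕ) :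
    MeasurableSet {p : Seq 3 × Seq 2 | Consistent p.1 k m p.2} := by
  induction k generalizing m with
  | zero => simp [Consistent]
  | succ k ih =>
    have : {p : Seq 3 × Seq 2 | Consistent p.1 (k + 1) m p.2} = ⋃ b : Fin 2,
        ({p | p.1 (2 * m + b) = 2} ∩ {p | Consistent p.1 k (2 * m + 1 + b) p.2}) ∪
        ({p | p.1 (2 * m + b) = (p.2 0).castSucc} ∩
          (fun p => (p.1, fun i => p.2 (i + 1))) ⁻¹'
            {p | Consistent p.1 k (2 * m + 1 + b) p.2}) := by
      ext p
      simp [Consistent]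
    rw [this]
    have hx : ∀ i, Measurable fun p : Seq 3 × Seq 2 => p.1 i := fun i => by fun_prop
    have hy : Measurable fun p : Seq 3 × Seq 2 => (p.2 0).castSucc :=
      (measurable_of_finite (Fin.castSucc : Fin 2 → Fin 3)).comp (by fun_prop)
    exact MeasurableSet.iUnion fun b =>
      ((measurableSet_eq_fun (hx _) measurable_const).inter (ih _)).union
        ((measurableSet_eq_fun (hx _) hy).inter
          (((show Measurable fun p : Seq 3 × Seq 2 => (p.1, fun i => p.2 (i + 1)) by fun_prop)) (ih _)))

theorem measurableSet_consistent_left (k m : ℕ) (y : Seq 2) :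
    MeasurableSet {x | Consistent x k m y} :=
  measurable_prodMk_right (y := y) (measurableSet_consistent_prod k m)

theorem measurableSet_consistent_right (k m : ℕ) (x : Seq 3) :
    MeasurableSet {y | Consistent x k m y} :=
  measurable_prodMk_left (x := x) (measurableSet_consistent_prod k m)

/-- The bound `1/4` is a fixed point of the extinction recursion `q = (1/3 + 2q/3)^2`: a child fails
if its label is the wrong digit, or if it is one of the two admissible labels and the search below
it fails. The two children are independent. -/
theorem lebesgue_not_consistent_le (k m : ℕ) (y : Seq 2) :
    lebesgue 3 {x | ¬ Consistent x k m y} ≤ 4⁻¹ := by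
  induction k generalizing m y with
  | zero => simp [Consistent]
  | succ k ih =>
    let B : Fin 2 → Set (Seq 3) := fun b => {x |
      ¬ ((x (2 * m + b) = 2 ∧ Consistent x k (2 * m + 1 + b) y) ∨
        (x (2 * m + b) = (y 0).castSucc ∧ Consistent x k (2 * m + 1 + b) fun i => y (i + 1)))}
    have hev : ∀ (i : ℕ) (a : Fin 3), MeasurableSet {x : Seq 3 | x i = a} := fun i a =>
      measurableSet_eq_fun (measurable_pi_apply i) measurable_const
    have hBm : ∀ b, MeasurableSet (B b) := fun b =>
      (((hev _ _).inter (measurableSet_consistent_left _ _ _)).union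
        ((hev _ _).inter (measurableSet_consistent_left _ _ _))).compl
    have hBd : ∀ b : Fin 2, DependsOn (· ∈ B b) (insert (2 * m + b : ℕ) (labelsBelow k (2 * m + 1 + b))) := by
      intro b x z h
      have h1 : x (2 * m + b) = z (2 * m + b) := h _ (Set.mem_insert _ _)
      have h2 : ∀ y, Consistent x k (2 * m + 1 + b) y = Consistent z k (2 * m + 1 + b) y :=
        fun y => dependsOn_consistent _ _ y fun i hi => h i (Set.mem_insert_of_mem _ hi)
      simp only [B, Set.mem_ofPred_eq, h1, h2]
    have hBle : ∀ b, lebesgue 3 (B b) ≤ 2⁻¹ := by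
      intro b
      have hprod : ∀ (a : Fin 3) (y : Seq 2),
          lebesgue 3 ({x | x (2 * m + b) = a} ∩ {x | ¬ Consistent x k (2 * m + 1 + b) y}) ≤
            3⁻¹ * 4⁻¹ := by
        intro a y
        rw [lebesgue_inter_of_dependsOn (E := {x | x (2 * m + b) = a})
          (E' := {x | ¬ Consistent x k (2 * m + 1 + b) y})
          (S := {2 * m + (b : ℕ)}) (T := labelsBelow k (2 * m + 1 + b))
          (hev _ _) (measurableSet_consistent_left _ _ _).compl (fun x z h => by simp [h _ rfl])
          (fun x z h => congrArg Not (dependsOn_consistent k _ y h))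
          (Set.disjoint_singleton_left.2 (add_notMem_labelsBelow_child k m b b)), lebesgue_eval_eq]
        exact mul_le_mul' le_rfl (ih _ _)
      have hsub : B b ⊆
          (({x | x (2 * m + b) = 2} ∩ {x | ¬ Consistent x k (2 * m + 1 + b) y}) ∪
          ({x | x (2 * m + b) = (y 0).castSucc} ∩
            {x | ¬ Consistent x k (2 * m + 1 + b) fun i => y (i + 1)})) ∪
          {x | x (2 * m + b) = (1 - y 0).castSucc} := by
        intro x hx
        have h3 : ∀ (a : Fin 3) (c : Fin 2), a = 2 ∨ a = c.castSucc ∨ a = (1 - c).castSucc := by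
          decide
        simp only [B, Set.mem_ofPred_eq, not_or, not_and] at hx
        rcases h3 (x (2 * m + b)) (y 0) with h | h | h
        · exact Or.inl (Or.inl ⟨h, hx.1 h⟩)
        · exact Or.inl (Or.inr ⟨h, hx.2 h⟩)
        · exact Or.inr h
      calc _ ≤ (3⁻¹ * 4⁻¹ + 3⁻¹ * 4⁻¹) + 3⁻¹ := by
            refine (measure_mono hsub).trans ((measure_union_le _ _).trans (add_le_add
              ((measure_union_le _ _).trans (add_le_add (hprod _ _) (hprod _ _))) ?_))
            rw [lebesgue_eval_eq, Nat.cast_ofNat]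
        _ = ((3⁻¹ * 4⁻¹ + 3⁻¹ * 4⁻¹ + 3⁻¹ : NNReal) : ENNReal) := by
            push_cast [ENNReal.coe_inv]
            rfl
        _ = ((2⁻¹ : NNReal) : ENNReal) := by
            congr 1
            rw [← NNReal.coe_inj]
            push_cast
            norm_num
        _ = 2⁻¹ := by push_cast [ENNReal.coe_inv]; rfl
    have hinter : {x | ¬ Consistent x (k + 1) m y} = B 0 ∩ B 1 := by
      ext x
      simp [Consistent, B, Fin.exists_fin_two]
    rw [hinter, lebesgue_inter_of_dependsOn (hBm 0) (hBm 1) (hBd 0) (hBd 1)]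
    · refine (mul_le_mul' (hBle 0) (hBle 1)).trans_eq ?_
      rw [← ENNReal.mul_inv (by simp) (by simp)]
      norm_num
    · rw [Set.disjoint_insert_left, Set.disjoint_insert_right]
      refine ⟨?_, add_notMem_labelsBelow_child k m 1 0, disjoint_labelsBelow_children k k m⟩
      rw [Set.mem_insert_iff, not_or]
      exact ⟨by simp, add_notMem_labelsBelow_child k m 0 1⟩

/-- The event that the sequences consistent with the labels in the first `k` levels below node `m`
have measure less than `2^(-j)`. -/
def thinRange (j k m : ℕ) : Set (Seq 3) :=
  {x | lebesgue 2 {y | Consistent x k m y} < 2⁻¹ ^ j}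

theorem measurableSet_thinRange (j k m : ℕ) : MeasurableSet (thinRange j k m) :=
  measurableSet_lt (measurable_measure_prodMk_left (measurableSet_consistent_prod k m))
    measurable_const

theorem dependsOn_thinRange (j k m : ℕ) : DependsOn (· ∈ thinRange j k m) (labelsBelow k m) := by
  intro x z h
  simp only [thinRange, Set.mem_ofPred_eq, fun y => dependsOn_consistent k m y h]

/-- A label `2` passes on every sequence consistent at the child; a digit prepends itself, which
halves the measure. -/
theorem thinRange_succ_subset (j k m : ℕ) (b : Fin 2) :
    thinRange (j + 1) (k + 1) m ⊆ thinRange j k (2 * m + 1 + b) := by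
  intro x hx
  rw [thinRange, Set.mem_ofPred_eq, pow_succ'] at hx
  have key : 2⁻¹ * lebesgue 2 {y | Consistent x k (2 * m + 1 + b) y} ≤
      lebesgue 2 {y | Consistent x (k + 1) m y} := by
    by_cases h : x (2 * m + b) = 2
    · calc _ ≤ 1 * lebesgue 2 {y | Consistent x k (2 * m + 1 + b) y} := by
            gcongr
            simp
        _ ≤ _ := by
            rw [one_mul]
            exact measure_mono fun y hy => ⟨b, Or.inl ⟨h, hy⟩⟩
    · have := lebesgue_eval_zero_and_tail ((x (2 * m + b)).castPred h)
        (measurableSet_consistent_right k (2 * m + 1 + b) x)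
      rw [Nat.cast_ofNat] at this
      rw [← this]
      refine measure_mono fun y hy => ⟨b, Or.inr ⟨?_, hy.2⟩⟩
      rw [hy.1, Fin.castSucc_castPred]
  exact lt_of_mul_lt_mul_left' (key.trans_lt hx)

/-- Fubini bounds the mean measure of the inconsistent sequences by `1/4`; Markov's inequality at
`1/2` does the rest. -/
theorem lebesgue_thinRange_one_le (k m : ℕ) : lebesgue 3 (thinRange 1 k m) ≤ 2⁻¹ := by
  have hmeas := (measurableSet_consistent_prod k m).compl
  have hfub : ∫⁻ x, lebesgue 2 {y | ¬ Consistent x k m y} ∂(lebesgue 3) ≤ 4⁻¹ := by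
    have h1 := Measure.prod_apply (μ := lebesgue 3) (ν := lebesgue 2) hmeas
    rw [Measure.prod_apply_symm hmeas] at h1
    refine h1.symm.trans_le ((lintegral_mono fun y => lebesgue_not_consistent_le k m y).trans ?_)
    simp
  have hsub : thinRange 1 k m ⊆ {x | 2⁻¹ ≤ lebesgue 2 {y | ¬ Consistent x k m y}} := by
    intro x hx
    have h := prob_compl_eq_one_sub (μ := lebesgue 2) (measurableSet_consistent_right k m x)
    change 2⁻¹ ≤ lebesgue 2 {y | Consistent x k m y}ᶜ
    rw [h]
    rw [thinRange, Set.mem_ofPred_eq, pow_one] at hx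
    calc (2⁻¹ : ENNReal) = 1 - 2⁻¹ := ENNReal.one_sub_inv_two.symm
      _ ≤ _ := tsub_le_tsub_left hx.le _
  have hmarkov := (mul_meas_ge_le_lintegral
    (measurable_measure_prodMk_left (ν := lebesgue 2) hmeas) 2⁻¹).trans hfub
  have h2 : 2⁻¹ * lebesgue 3 (thinRange 1 k m) ≤ 2⁻¹ * 2⁻¹ := by
    refine (mul_le_mul' le_rfl (measure_mono hsub)).trans (hmarkov.trans_eq ?_)
    rw [← ENNReal.mul_inv (by simp) (by simp)]
    norm_num
  exact (ENNReal.mul_le_mul_iff_right (by simp) (by simp)).1 h2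

/-- Passing to the two independent children squares the bound, and `(2^(-i-1))^2 ≤ 2^(-i-2)`. The
recursion on `i` starts from the Markov bound. -/
theorem lebesgue_thinRange_succ_le (i k m : ℕ) :
    lebesgue 3 (thinRange (i + 1) k m) ≤ 2⁻¹ ^ (i + 1) := by
  induction k generalizing i m with
  | zero =>
    have : thinRange (i + 1) 0 m = ∅ := by
      refine Set.eq_empty_of_forall_notMem fun x hx => ?_
      simp only [thinRange, Consistent, Set.mem_ofPred_eq, Set.ofPred_true, measure_univ] at hx
      exact absurd hx (not_lt.2 (pow_le_one' (by simp) _))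
    simp [this]
  | succ k ih =>
    rcases i with _ | i
    · simpa using lebesgue_thinRange_one_le (k + 1) m
    · calc _ ≤ lebesgue 3 (thinRange (i + 1) k (2 * m + 1) ∩ thinRange (i + 1) k (2 * m + 2)) :=
            measure_mono fun x hx => ⟨thinRange_succ_subset _ _ m 0 hx,
              thinRange_succ_subset _ _ m 1 hx⟩
        _ = _ := lebesgue_inter_of_dependsOn (measurableSet_thinRange _ _ _)
              (measurableSet_thinRange _ _ _) (dependsOn_thinRange _ _ _)
              (dependsOn_thinRange _ _ _) (disjoint_labelsBelow_children _ _ _)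
        _ ≤ 2⁻¹ ^ (i + 1) * 2⁻¹ ^ (i + 1) := mul_le_mul' (ih _ _) (ih _ _)
        _ ≤ _ := by
            rw [← pow_add]
            exact pow_le_pow_right_of_le_one' (by simp) (by omega)

theorem Consistent.of_succ {x : Seq 3} {k m : ℕ} {y : Seq 2} (h : Consistent x (k + 1) m y) :
    Consistent x k m y := by
  induction k generalizing m y with
  | zero => trivial
  | succ k ih =>
    obtain ⟨b, h | h⟩ := h
    · exact ⟨b, Or.inl ⟨h.1, ih h.2⟩⟩
    · exact ⟨b, Or.inr ⟨h.1, ih h.2⟩⟩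

theorem Consistent.of_le {x : Seq 3} {k l m : ℕ} {y : Seq 2} (h : Consistent x k m y)
    (hl : l ≤ k) : Consistent x l m y := by
  induction hl with
  | refl => exact h
  | step _ ih => exact ih h.of_succ

theorem lebesgue_exists_thinRange_le (i : ℕ) :
    lebesgue 3 {x | ∃ k, x ∈ thinRange (i + 1) k 0} ≤ 2⁻¹ ^ i := by
  have hmono : Monotone fun k => thinRange (i + 1) k 0 := fun k l h x hx =>
    (measure_mono fun y hy => Consistent.of_le hy h).trans_lt hx
  rw [show {x | ∃ k, x ∈ thinRange (i + 1) k 0} = ⋃ k, thinRange (i + 1) k 0 by ext; simp,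
    hmono.measure_iUnion]
  exact iSup_le fun k => (lebesgue_thinRange_succ_le i k 0).trans
    (pow_le_pow_right_of_le_one' (by simp) (by omega))

/-! ### The range of a random continuous function: computability -/

/-- The sequence that continues `σ` by `2`s. -/
def pad (σ : Str 3) : Seq 3 := fun i => σ.getD i 2

theorem pad_restrict {x : Seq 3} {i k : ℕ} (h : i < k) : pad (restrict x k) i = x i := by
  rw [pad, List.getD_eq_getElem?_getD, getElem?_restrict x h, Option.getD_some]

/-- What remains of the task `(m, w)`, to follow the string `w` from node `m` on, after moving to the
child `b` of that node. -/
def moveTo (x : Seq 3) (s : ℕ × Str 2) (b : Fin 2) : List (ℕ × Str 2) :=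
  if x (2 * s.1 + b) = 2 then [(2 * s.1 + 1 + b, s.2)]
  else if s.2.head?.map Fin.castSucc = some (x (2 * s.1 + b)) then [(2 * s.1 + 1 + b, s.2.tail)]
  else []

/-- What remains of the tasks in a list after moving to the children in all possible ways. -/
def moveDown (x : Seq 3) (l : List (ℕ × Str 2)) : List (ℕ × Str 2) :=
  l.flatMap fun s => moveTo x s 0 ++ moveTo x s 1

theorem iterate_moveDown_ne_nil_iff (x : Seq 3) (k : ℕ) (l : List (ℕ × Str 2)) :
    (moveDown x)^[k] l ≠ [] ↔ ∃ s ∈ l, (moveDown x)^[k] [s] ≠ [] := by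
  induction k generalizing l with
  | zero => simp [List.eq_nil_iff_forall_not_mem]
  | succ k ih =>
    simp only [Function.iterate_succ_apply]
    rw [ih]
    constructor
    · rintro ⟨s, hs, h⟩
      obtain ⟨t, ht, hs⟩ := List.mem_flatMap.1 hs
      exact ⟨t, ht, (ih _).2 ⟨s, by simpa [moveDown] using hs, h⟩⟩
    · rintro ⟨t, ht, h⟩
      obtain ⟨s, hs, h⟩ := (ih _).1 h
      exact ⟨s, List.mem_flatMap.2 ⟨t, ht, by simpa [moveDown] using hs⟩, h⟩

/-- Each level consumes at most one digit of `y`, so a prefix of length at least `k` is never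
exhausted. -/
theorem consistent_iff_iterate_moveDown (x : Seq 3) {k l : ℕ} (m : ℕ) (y : Seq 2) (hl : k ≤ l) :
    Consistent x k m y ↔ (moveDown x)^[k] [(m, restrict y l)] ≠ [] := by
  induction k generalizing l m y with
  | zero => simp [Consistent]
  | succ k ih =>
    obtain ⟨l, rfl⟩ : ∃ l', l = l' + 1 := ⟨l - 1, by omega⟩
    rw [Function.iterate_succ_apply, iterate_moveDown_ne_nil_iff, Consistent]
    have hmove : ∀ b : Fin 2, (x (2 * m + b) = 2 ∧ Consistent x k (2 * m + 1 + b) y ∨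
        x (2 * m + b) = (y 0).castSucc ∧ Consistent x k (2 * m + 1 + b) fun i => y (i + 1)) ↔
        ∃ s ∈ moveTo x (m, restrict y (l + 1)) b, (moveDown x)^[k] [s] ≠ [] := by
      intro b
      rw [ih (l := l + 1) _ y (by omega), ih (l := l) _ (fun i => y (i + 1)) (by omega), moveTo]
      by_cases h : x (2 * m + b) = 2
      -- A digit is never `2`, so the two alternatives exclude each other, as in the case
      -- distinction of `moveTo`.
      · have h' : ¬ (2 : Fin 3) = (y 0).castSucc := by
          generalize y 0 = c
          revert c
          decide
        simp [h, h']
      · rw [if_neg h]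
        simp only [restrict_succ_eq_cons y l, List.head?_cons, Option.map_some, List.tail_cons,
          h, false_and, false_or, Option.some.injEq, eq_comm (a := (y 0).castSucc)]
        split_ifs with h2 <;> simp [h2]
    simp only [hmove, Fin.exists_fin_two, moveDown, List.flatMap_cons, List.flatMap_nil,
      List.append_nil, List.mem_append, or_and_right, exists_or]

/-- The list of the binary strings of length `k`. -/
def strings : ℕ → List (Str 2)
  | 0 => [[]]
  | k + 1 => (strings k).flatMap fun w => [0 :: w, 1 :: w]

theorem mem_strings {k : ℕ} {w : Str 2} : w ∈ strings k ↔ w.length = k := by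
  induction k generalizing w with
  | zero => simp [strings]
  | succ k ih =>
    simp only [strings, List.mem_flatMap, ih, List.mem_cons, List.not_mem_nil, or_false]
    constructor
    · rintro ⟨v, rfl, rfl | rfl⟩ <;> rfl
    · intro h
      obtain ⟨b, v, rfl⟩ := List.exists_cons_of_length_eq_add_one h
      refine ⟨v, by simpa using h, ?_⟩
      fin_cases b <;> simp

theorem nodup_strings (k : ℕ) : (strings k).Nodup := by
  induction k with
  | zero => simp [strings]
  | succ k ih =>
    rw [strings, List.nodup_flatMap]
    refine ⟨fun w _ => by simp, ih.imp ?_⟩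
    intro v w h
    simp [Function.onFun, h.symm]

/-- Only the first `k` digits of `y` matter, so the measure is a computable count of disjoint
cylinders. -/
theorem lebesgue_consistent (x : Seq 3) (k m : ℕ) :
    lebesgue 2 {y | Consistent x k m y} =
      ((strings k).filter fun w => (moveDown x)^[k] [(m, w)] ≠ []).length * 2⁻¹ ^ k := by
  set L := (strings k).filter fun w => (moveDown x)^[k] [(m, w)] ≠ [] with hL
  have hU : {y | Consistent x k m y} = ⋃ w ∈ L.toFinset, cylinder w := by
    ext y
    simp only [Set.mem_ofPred_eq, Set.mem_iUnion, List.mem_toFinset, hL, List.mem_filter,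
      mem_strings, exists_prop, consistent_iff_iterate_moveDown x m y le_rfl, decide_eq_true_eq]
    constructor
    · intro h
      exact ⟨restrict y k, ⟨by simp, h⟩, by simp [cylinder]⟩
    · rintro ⟨w, ⟨hw, h⟩, hy⟩
      change restrict y _ = w at hy
      rw [hw] at hy
      rwa [hy]
  have hlen : ∀ w ∈ L.toFinset, w.length = k := by
    intro w hw
    rw [List.mem_toFinset, hL, List.mem_filter] at hw
    exact mem_strings.1 hw.1
  rw [hU, measure_biUnion_finset _ fun w _ => measurableSet_cylinder w]
  · rw [Finset.sum_congr rfl fun w hw => by rw [lebesgue_cylinder, hlen w hw, Nat.cast_ofNat],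
      Finset.sum_const, nsmul_eq_mul, List.toFinset_card_of_nodup ((nodup_strings k).filter _)]
  · intro v hv w hw hne
    refine Set.disjoint_left.2 fun y hyv hyw => hne ?_
    change restrict y _ = v at hyv
    change restrict y _ = w at hyw
    rw [← hyv, ← hyw, hlen v hv, hlen w hw]

theorem mem_thinRange_iff (x : Seq 3) (j k m : ℕ) :
    x ∈ thinRange j k m ↔
      ((strings k).filter fun w => (moveDown x)^[k] [(m, w)] ≠ []).length * 2 ^ j < 2 ^ k := by
  rw [thinRange, Set.mem_ofPred_eq, lebesgue_consistent]
  generalize List.length _ = c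
  rw [← ENNReal.inv_pow, ← ENNReal.inv_pow, ← div_eq_mul_inv,
    ENNReal.div_lt_iff (by simp) (by simp), mul_comm (_ ⁻¹), ← div_eq_mul_inv,
    ENNReal.lt_div_iff_mul_lt (by simp) (by simp)]
  norm_cast

theorem primrec_strings : Primrec strings := by
  refine (Primrec.nat_rec₁ (f := fun _ l => l.flatMap fun w => [0 :: w, 1 :: w]) [[]]
    (Primrec₂.mk (Primrec.list_flatMap Primrec.snd (Primrec₂.mk ?_)))).of_eq fun k => ?_
  · exact Primrec.list_cons.comp (Primrec.list_cons.comp (Primrec.const 0) Primrec.snd)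
      (Primrec.list_cons.comp (Primrec.list_cons.comp (Primrec.const 1) Primrec.snd)
        (Primrec.const []))
  · induction k with
    | zero => rfl
    | succ k ih => simp only [strings, ← ih]

theorem primrec_moveTo (b : Fin 2) :
    Primrec fun p : Str 3 × ℕ × Str 2 => moveTo (pad p.1) p.2 b := by
  have hm : Primrec fun p : Str 3 × ℕ × Str 2 => 2 * p.2.1 :=
    Primrec.nat_mul.comp (Primrec.const 2) (Primrec.fst.comp Primrec.snd)
  have hw : Primrec fun p : Str 3 × ℕ × Str 2 => p.2.2 := Primrec.snd.comp Primrec.snd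
  have hx : Primrec fun p : Str 3 × ℕ × Str 2 => pad p.1 (2 * p.2.1 + b) :=
    (Primrec.list_getD 2).comp Primrec.fst (Primrec.nat_add.comp hm (Primrec.const _))
  have hc : Primrec fun p : Str 3 × ℕ × Str 2 => 2 * p.2.1 + 1 + b :=
    Primrec.nat_add.comp (Primrec.succ.comp hm) (Primrec.const _)
  exact Primrec.ite (Primrec.eq.comp hx (Primrec.const 2))
    (Primrec.list_cons.comp (hc.pair hw) (Primrec.const []))
    (Primrec.ite (Primrec.eq.comp (((Primrec.dom_finite (Option.map Fin.castSucc)).comp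
        (Primrec.list_head?.comp hw))) (Primrec.option_some.comp hx))
      (Primrec.list_cons.comp (hc.pair (Primrec.list_tail.comp hw)) (Primrec.const []))
      (Primrec.const []))

theorem primrec_moveDown :
    Primrec₂ fun (σ : Str 3) (l : List (ℕ × Str 2)) => moveDown (pad σ) l :=
  Primrec.list_flatMap Primrec.snd (Primrec₂.mk (Primrec.list_append.comp
    ((primrec_moveTo 0).comp ((Primrec.fst.comp Primrec.fst).pair Primrec.snd))
    ((primrec_moveTo 1).comp ((Primrec.fst.comp Primrec.fst).pair Primrec.snd))))

theorem primrecPred_mem_thinRange :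
    PrimrecPred fun p : ℕ × ℕ × Str 3 => pad p.2.2 ∈ thinRange (p.1 + 1) p.2.1 0 := by
  have hrel : PrimrecRel fun (w : Str 2) (q : ℕ × Str 3) =>
      (moveDown (pad q.2))^[q.1] [(0, w)] ≠ [] := by
    refine PrimrecPred.not (Primrec.eq.comp (Primrec.nat_iterate
      (f := fun p : Str 2 × ℕ × Str 3 => p.2.1) (g := fun p => [(0, p.1)])
      (h := fun p l => moveDown (pad p.2.2) l) (Primrec.fst.comp Primrec.snd) ?_
      (Primrec₂.mk ?_)) (Primrec.const []))
    · exact Primrec.list_cons.comp ((Primrec.const 0).pair Primrec.fst) (Primrec.const [])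
    · exact primrec_moveDown.comp (Primrec.snd.comp (Primrec.snd.comp Primrec.fst)) Primrec.snd
  have hlt : PrimrecPred fun p : ℕ × ℕ × Str 3 =>
      ((strings p.2.1).filter fun w => (moveDown (pad p.2.2))^[p.2.1] [(0, w)] ≠ []).length *
        2 ^ (p.1 + 1) < 2 ^ p.2.1 :=
    Primrec.nat_lt.comp
      (Primrec.nat_mul.comp
        (Primrec.list_length.comp (hrel.listFilter.comp
          (primrec_strings.comp (Primrec.fst.comp Primrec.snd)) Primrec.snd))
        (primrec_pow.comp (Primrec.const 2) (Primrec.succ.comp Primrec.fst)))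
      (primrec_pow.comp (Primrec.const 2) (Primrec.fst.comp Primrec.snd))
  exact hlt.of_eq fun p => (mem_thinRange_iff _ _ _ _).symm

/-- The padding is immaterial: the first `k` levels use only positions below `2^(k+1)`. -/
theorem pad_restrict_mem_thinRange_iff (x : Seq 3) (j : ℕ) {k n : ℕ} (h : 2 ^ (k + 1) ≤ n) :
    pad (restrict x n) ∈ thinRange j k 0 ↔ x ∈ thinRange j k 0 :=
  iff_of_eq (dependsOn_thinRange j k 0 fun _ hi =>
    pad_restrict ((lt_of_mem_labelsBelow_zero hi).trans_le h))

theorem IsMartinLofRandom.exists_notMem_thinRange {x : Seq 3}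
    (hx : IsMartinLofRandom (lebesgue 3) x) : ∃ j, ∀ k, x ∉ thinRange j k 0 := by
  obtain ⟨i, hi⟩ := hx.exists_forall_not
    -- The bound `k < p.2.length` follows from the next condition, but makes the search visibly
    -- bounded.
    (P := fun p => ∃ k < p.2.length, 2 ^ (k + 1) ≤ p.2.length ∧ pad p.2 ∈ thinRange (p.1 + 1) k 0)
    (by
      have hrel : PrimrecRel fun (k : ℕ) (p : ℕ × Str 3) =>
          2 ^ (k + 1) ≤ p.2.length ∧ pad p.2 ∈ thinRange (p.1 + 1) k 0 :=
        PrimrecPred.and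
          (Primrec.nat_le.comp
            (primrec_pow.comp (Primrec.const 2) (Primrec.succ.comp Primrec.fst))
            (Primrec.list_length.comp (Primrec.snd.comp Primrec.snd)))
          (primrecPred_mem_thinRange.comp ((Primrec.fst.comp Primrec.snd).pair
            (Primrec.fst.pair (Primrec.snd.comp Primrec.snd))))
      exact (hrel.exists_mem_list.comp (Primrec.list_range.comp
        (Primrec.list_length.comp Primrec.snd)) Primrec.id).of_eq fun p => by simp)
    (fun i => by
      refine (measure_mono ?_).trans (lebesgue_exists_thinRange_le i)
      rintro x ⟨n, k, _, hn, h⟩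
      rw [length_restrict] at hn
      exact ⟨k, (pad_restrict_mem_thinRange_iff x _ hn).1 h⟩)
  refine ⟨i + 1, fun k hk => hi (2 ^ (k + 1)) ⟨k, ?_, ?_, ?_⟩⟩
  · rw [length_restrict]
    exact (Nat.lt_succ_self k).trans Nat.lt_two_pow_self
  · rw [length_restrict]
  · exact (pad_restrict_mem_thinRange_iff x _ le_rfl).2 hk

/-! ### Random continuous functions are total -/

theorem take_restrict {n : ℕ} (x : Seq n) {k l : ℕ} (h : k ≤ l) :
    (restrict x l).take k = restrict x k := by
  rw [restrict, restrict, ← List.map_take, List.take_range, min_eq_left h]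

theorem exists_restrict_eq {n : ℕ} [NeZero n] (σ : Str n) : ∃ x : Seq n, restrict x σ.length = σ := by
  refine ⟨fun i => σ.getD i 0, List.ext_getElem (by simp) fun i h1 h2 => ?_⟩
  simp [restrict, h2]

/-- The fold in `lexIndex` runs over `σ` coerced to `List ℕ`; here it runs over `σ` itself. -/
theorem lexIndex_eq_foldl (σ : Str 2) :
    lexIndex σ = σ.foldl (fun m (b : Fin 2) => 2 * m + 1 + b.val) 0 := by
  have : (do let a ← σ; pure (a : ℕ)) = σ.map Fin.val := by
    simp only [List.bind_eq_flatMap, List.pure_def]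
    exact List.map_eq_flatMap.symm
  rw [lexIndex, this, List.foldl_map]

theorem lexIndex_restrict_succ (z : Seq 2) (k : ℕ) :
    lexIndex (restrict z (k + 1)) = 2 * lexIndex (restrict z k) + 1 + z k := by
  rw [restrict_succ, lexIndex_eq_foldl, lexIndex_eq_foldl, List.foldl_append]
  rfl

theorem labelsAlong_eq (x : Seq 3) (z : Seq 2) (k : ℕ) :
    labelsAlong x z k = x (2 * lexIndex (restrict z k) + z k) := by
  rw [labelsAlong, label, lexIndex_restrict_succ]
  congr 1
  omega

theorem strictMono_lexIndex_restrict (z : Seq 2) :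
    StrictMono fun k => lexIndex (restrict z (k + 1)) - 1 :=
  strictMono_nat_of_lt_succ fun k => by
    have := lexIndex_restrict_succ z (k + 1)
    have := lexIndex_restrict_succ z k
    omega

theorem lebesgue_forall_labelsAlong_eq_two (z : Seq 2) (a N : ℕ) :
    lebesgue 3 {x | ∀ j < N, labelsAlong x z (a + j) = 2} = 3⁻¹ ^ N := by
  have hinj : Function.Injective fun j => lexIndex (restrict z (a + j + 1)) - 1 :=
    (strictMono_lexIndex_restrict z).injective.comp (add_right_injective a)
  have h := lebesgue_forall_mem (n := 3)
    ((Finset.range N).image fun j => lexIndex (restrict z (a + j + 1)) - 1) fun _ => 2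
  rw [Finset.card_image_of_injective _ hinj, Finset.card_range, Nat.cast_ofNat] at h
  rw [← h]
  congr 1
  ext x
  simp [labelsAlong, label]

/-- Some path of length `a + N` has only labels `2` in its last `N` levels, as far as is known from
the initial segment `σ` of the sequence of all labels. -/
def HasRunOfTwos (a N : ℕ) (σ : Str 3) : Prop :=
  ∃ v ∈ strings (a + N), ∀ j ∈ List.range N, σ[lexIndex (v.take (a + j + 1)) - 1]? = some 2

/-- Union bound over all strings of length `a + N`; labels along one path sit at distinct positions,
hence are independent. -/
theorem lebesgue_hasRunOfTwos_le (a N : ℕ) :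
    lebesgue 3 {x | ∃ k, HasRunOfTwos a N (restrict x k)} ≤ 2 ^ (a + N) * 3⁻¹ ^ N := by
  have hcard : (strings (a + N)).toFinset.card ≤ 2 ^ (a + N) := by
    refine (List.toFinset_card_le _).trans (le_of_eq ?_)
    induction a + N with
    | zero => rfl
    | succ k ih => simp [strings, ih, pow_succ]
  choose z hz using exists_restrict_eq (n := 2)
  have hsub : {x | ∃ k, HasRunOfTwos a N (restrict x k)} ⊆
      ⋃ v ∈ (strings (a + N)).toFinset, {x | ∀ j < N, labelsAlong x (z v) (a + j) = 2} := by
    rintro x ⟨k, v, hv, h⟩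
    simp only [Set.mem_iUnion]
    refine ⟨v, List.mem_toFinset.2 hv, fun j hj => ?_⟩
    have h1 := h j (List.mem_range.2 hj)
    rw [← hz v, take_restrict _ (by rw [mem_strings.1 hv]; omega)] at h1
    obtain ⟨hlt, h2⟩ := List.getElem?_eq_some_iff.1 h1
    rw [labelsAlong, label, ← h2]
    simp [restrict]
  calc _ ≤ ∑ v ∈ (strings (a + N)).toFinset,
        lebesgue 3 {x | ∀ j < N, labelsAlong x (z v) (a + j) = 2} :=
        (measure_mono hsub).trans (measure_biUnion_finset_le _ _)
    _ ≤ _ := by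
        simp only [lebesgue_forall_labelsAlong_eq_two, Finset.sum_const, nsmul_eq_mul]
        gcongr
        exact_mod_cast hcard

theorem primrec_lexIndex : Primrec lexIndex := by
  refine (Primrec.list_foldl Primrec.id (Primrec.const 0)
    (h := fun _ (p : ℕ × Fin 2) => 2 * p.1 + 1 + p.2.val) (Primrec₂.mk ?_)).of_eq
      fun σ => (lexIndex_eq_foldl σ).symm
  exact Primrec.nat_add.comp
    (Primrec.nat_double_succ.comp (Primrec.fst.comp Primrec.snd))
    (Primrec.fin_val.comp (Primrec.snd.comp Primrec.snd))

theorem primrecPred_hasRunOfTwos (a : ℕ) :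
    PrimrecPred fun p : ℕ × Str 3 => HasRunOfTwos a p.1 p.2 := by
  have hinner : PrimrecRel fun (j : ℕ) (q : Str 2 × Str 3) =>
      q.2[lexIndex (q.1.take (a + j + 1)) - 1]? = some 2 :=
    Primrec.eq.comp
      (Primrec.list_getElem?.comp (Primrec.snd.comp Primrec.snd)
        (Primrec.nat_sub.comp
          (primrec_lexIndex.comp (Primrec.list_take.comp
            (Primrec.succ.comp (Primrec.nat_add.comp (Primrec.const a) Primrec.fst))
            (Primrec.fst.comp Primrec.snd)))
          (Primrec.const 1)))
      (Primrec.const _)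
  have houter : PrimrecRel fun (v : Str 2) (p : ℕ × Str 3) =>
      ∀ j ∈ List.range p.1, p.2[lexIndex (v.take (a + j + 1)) - 1]? = some 2 :=
    hinner.forall_mem_list.comp (Primrec.list_range.comp (Primrec.fst.comp Primrec.snd))
      (Primrec.fst.pair (Primrec.snd.comp Primrec.snd))
  exact houter.exists_mem_list.comp
    (primrec_strings.comp (Primrec.nat_add.comp (Primrec.const a) Primrec.fst)) Primrec.id

/-- Runs of length `2(i + a)` suffice because `(2/3)^2 ≤ 1/2`; the extra `a` absorbs the factor
`2^a`. -/
theorem two_pow_mul_three_inv_pow_le (a i : ℕ) :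
    (2 : ENNReal) ^ (a + 2 * (i + a)) * 3⁻¹ ^ (2 * (i + a)) ≤ 2⁻¹ ^ i := by
  have h : (2 : NNReal) ^ (a + 2 * (i + a)) * 3⁻¹ ^ (2 * (i + a)) ≤ 2⁻¹ ^ i := by
    calc (2 : NNReal) ^ (a + 2 * (i + a)) * 3⁻¹ ^ (2 * (i + a)) =
          2 ^ a * (2 ^ 2 * 3⁻¹ ^ 2) ^ (i + a) := by
          rw [pow_add, pow_mul, pow_mul (3⁻¹ : NNReal), mul_assoc, mul_pow]
      _ ≤ 2 ^ a * 2⁻¹ ^ (i + a) := by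
          gcongr
          rw [← NNReal.coe_le_coe]
          push_cast
          norm_num
      _ = 2⁻¹ ^ i := by
          rw [add_comm i, pow_add, ← mul_assoc, ← mul_pow, mul_inv_cancel₀ two_ne_zero, one_pow,
            one_mul]
  have h' := ENNReal.coe_le_coe.2 h
  push_cast [ENNReal.coe_inv] at h'
  exact h'

/-- If only `2`s occurred after level `c`, runs of every length would start there. The test treats
all paths at once, so `z` need not be computable. -/
theorem IsMartinLofRandom.infinite_labelsAlong_ne_two {x : Seq 3}
    (hx : IsMartinLofRandom (lebesgue 3) x) (z : Seq 2) :
    {k | labelsAlong x z k ≠ 2}.Infinite := by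
  rw [Set.infinite_iff_exists_gt]
  intro c
  obtain ⟨i, hi⟩ := hx.exists_forall_not
    (P := fun p => HasRunOfTwos (c + 1) (2 * (p.1 + (c + 1))) p.2)
    ((primrecPred_hasRunOfTwos (c + 1)).comp
      ((Primrec.nat_mul.comp (Primrec.const 2)
        (Primrec.nat_add.comp Primrec.fst (Primrec.const _))).pair Primrec.snd))
    fun i => (lebesgue_hasRunOfTwos_le _ _).trans (two_pow_mul_three_inv_pow_le _ _)
  by_contra! h
  have htwo : ∀ k, c < k → labelsAlong x z k = 2 := fun k hk => by
    by_contra hne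
    exact absurd (h k hne) (not_le.2 hk)
  -- The number of a deeper node on the path exceeds every position read in the run.
  refine hi (lexIndex (restrict z (c + 1 + 2 * (i + (c + 1)) + 1)))
    ⟨restrict z (c + 1 + 2 * (i + (c + 1))), mem_strings.2 (by simp), fun j hj => ?_⟩
  rw [List.mem_range] at hj
  rw [take_restrict _ (by omega), getElem?_restrict, Option.some.injEq]
  · exact htwo (c + 1 + j) (by omega)
  · have h1 := (strictMono_lexIndex_restrict z)
      (show c + 1 + j < c + 1 + 2 * (i + (c + 1)) by omega)
    simp only at h1
    omega

/-! ### The range of a random continuous function has positive measure -/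

/-- König's lemma: otherwise each of the four continuations (child, label kind) fails at some depth,
and node `m` fails at any larger depth. -/
theorem exists_child_of_forall_consistent {x : Seq 3} {m : ℕ} {y : Seq 2}
    (h : ∀ k, Consistent x k m y) :
    ∃ (b : Fin 2) (y' : Seq 2), (∀ k, Consistent x k (2 * m + 1 + b) y') ∧
      (x (2 * m + b) = 2 ∧ y' = y ∨ x (2 * m + b) = (y 0).castSucc ∧ y' = fun i => y (i + 1)) := by
  by_contra! hno
  have h1 : ∀ b : Fin 2, ∃ k, ¬ (x (2 * m + b) = 2 ∧ Consistent x k (2 * m + 1 + b) y) := by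
    intro b
    by_contra! hb
    exact (hno b y fun k => (hb k).2).1 (hb 0).1 rfl
  have h2 : ∀ b : Fin 2, ∃ k, ¬ (x (2 * m + b) = (y 0).castSucc ∧
      Consistent x k (2 * m + 1 + b) fun i => y (i + 1)) := by
    intro b
    by_contra! hb
    exact (hno b _ fun k => (hb k).2).2 (hb 0).1 rfl
  choose f hf using h1
  choose g hg using h2
  obtain ⟨b, hb | hb⟩ := h (∑ b, (f b + g b) + 1)
  · have := Finset.single_le_sum (f := fun b => f b + g b) (fun _ _ => Nat.zero_le _) (Finset.mem_univ b)
    exact hf b ⟨hb.1, hb.2.of_le (by omega)⟩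
  · have := Finset.single_le_sum (f := fun b => f b + g b) (fun _ _ => Nat.zero_le _) (Finset.mem_univ b)
    exact hg b ⟨hb.1, hb.2.of_le (by omega)⟩

theorem mem_ran_codedFunction {x : Seq 3} (hx : IsMartinLofRandom (lebesgue 3) x) {y : Seq 2}
    (hy : ∀ k, Consistent x k 0 y) : y ∈ (codedFunction x).ran := by
  let S : Type := {s : ℕ × Seq 2 // ∀ k, Consistent x k s.1 s.2}
  choose b t ht hbt using fun s : S => exists_child_of_forall_consistent s.2
  let s : ℕ → S := fun n => (fun s : S => ⟨(2 * s.1.1 + 1 + b s, t s), ht s⟩)^[n] ⟨(0, y), hy⟩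
  have hs : ∀ n, (s (n + 1)).1 = (2 * (s n).1.1 + 1 + b (s n), t (s n)) := fun n => by
    simp only [s, Function.iterate_succ_apply']
  let z : Seq 2 := fun n => b (s n)
  have hm : ∀ n, (s n).1.1 = lexIndex (restrict z n) := by
    intro n
    induction n with
    | zero => rfl
    | succ n ih => rw [lexIndex_restrict_succ, ← ih, hs]
  have hlab : ∀ n, labelsAlong x z n = 2 ∧ (s (n + 1)).1.2 = (s n).1.2 ∨
      labelsAlong x z n = ((s n).1.2 0).castSucc ∧
        (s (n + 1)).1.2 = fun i => (s n).1.2 (i + 1) := by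
    intro n
    rw [labelsAlong_eq, ← hm, hs]
    exact hbt (s n)
  have hne : ∀ c : Fin 2, c.castSucc ≠ (2 : Fin 3) := by decide
  -- After `n` levels the target still to be spelled is `y` without as many digits as there were
  -- labels other than `2`; at the `j`-th such label its head is `y j`.
  have hshift : ∀ n i, (s n).1.2 i = y (i + Nat.count (fun k => labelsAlong x z k ≠ 2) n) := by
    intro n
    induction n with
    | zero => exact fun i => by simp [s]
    | succ n ih =>
      intro i
      rw [Nat.count_succ]
      rcases hlab n with ⟨h1, h2⟩ | ⟨h1, h2⟩
      · simp [h1, h2, ih]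
      · have h3 : labelsAlong x z n ≠ 2 := h1 ▸ hne _
        rw [if_pos h3, h2]
        beta_reduce
        rw [ih]
        congr 1
        omega
  have hinf := hx.infinite_labelsAlong_ne_two z
  refine ⟨z, hinf, funext fun j => Fin.castSucc_injective _ ?_⟩
  have hnth : labelsAlong x z (Nat.nth (fun k => labelsAlong x z k ≠ 2) j) ≠ 2 :=
    Nat.nth_mem_of_infinite hinf j
  rcases hlab (Nat.nth (fun k => labelsAlong x z k ≠ 2) j) with ⟨h1, _⟩ | ⟨h1, _⟩
  · exact absurd h1 hnth
  · rw [hshift, zero_add, Nat.count_nth_of_infinite hinf] at h1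
    exact (Fin.castSucc_castPred _ hnth).trans h1

/-- Continuity from above preserves the uniform lower bound `2^(-j)`. The range enters only through
monotonicity, so its measurability plays no role. -/
theorem lebesgue_ran_codedFunction_pos {x : Seq 3} (hx : IsMartinLofRandom (lebesgue 3) x) :
    0 < lebesgue 2 (codedFunction x).ran := by
  obtain ⟨j, hj⟩ := hx.exists_notMem_thinRange
  have hanti : Antitone fun k => {y | Consistent x k 0 y} := fun k l h y hy => Consistent.of_le hy h
  calc (0 : ENNReal) < 2⁻¹ ^ j := ENNReal.pow_pos (by simp) _
    _ ≤ lebesgue 2 (⋂ k, {y | Consistent x k 0 y}) := by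
        rw [hanti.measure_iInter
          (fun k => (measurableSet_consistent_right k 0 x).nullMeasurableSet)
          ⟨0, measure_ne_top _ _⟩]
        exact le_iInf fun k => not_lt.1 (hj k)
    _ ≤ _ := measure_mono fun y hy => mem_ran_codedFunction hx (Set.mem_iInter.1 hy)

end AlgRandom

theorem mainTheorem10 :
    (∀ C : Set (AlgRandom.Seq 2),
      AlgRandom.IsRandomClosedSet C → AlgRandom.lebesgue 2 C = 0) ∧
    (∀ F : AlgRandom.Seq 2 →. AlgRandom.Seq 2, AlgRandom.IsRandomContinuousFunction F →
      0 < AlgRandom.lebesgue 2 F.ran ∧ ¬ AlgRandom.IsRandomClosedSet F.ran) := by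
  have hclosed : ∀ C : Set (AlgRandom.Seq 2),
      AlgRandom.IsRandomClosedSet C → AlgRandom.lebesgue 2 C = 0 := by
    rintro C ⟨x, hx, rfl⟩
    exact AlgRandom.lebesgue_paths_codedTree_eq_zero hx
  refine ⟨hclosed, ?_⟩
  rintro F ⟨x, hx, rfl⟩
  have hpos := AlgRandom.lebesgue_ran_codedFunction_pos hx
  exact ⟨hpos, fun h => hpos.ne' (hclosed _ h)⟩
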